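/- Let $(A,\vec b)$, $A\in\mathbb{R}^{s\times s}$, $\vec b\in\mathbb{R}^s$, be an $s$-stage Runge--Kutta scheme with abscissas $\vec c=A\vec e$, $\vec e=(1,\dots,1)^T$, and suppose that it is diagonally implicit (DIRK), i.e. $a_{ij}=0$ for $j>i$. Let $n_c$ be the number of distinct values among $c_1,\dots,c_s$. Let the scheme have classical order (at least) $p$, i.e. for smooth initial value problems the error of a single step of size $\Delta t$ is $O(\Delta t^{p+1})$ as $\Delta t\to 0$. The weak stage order (WSO) is the largest integer $q$ such that $$\vec b^{\,T}A^j\vec\tau^{(k)}=0\quad\text{for all } 0\le j\le s-1,\ 1\le k\le q,\qquad \vec\tau^{(k)}:=A\vec c^{\,k-1}-\tfrac1k\vec c^{\,k}$$ (powers of $\vec c$ are componentwise), and it is $\infty$ if this holds for every $q$. The scheme is called a GEDIRK scheme if $\vec c$ has a zero entry and $a_{\ell\ell}=0$, where $\ell$ is the index of the first zero entry of $\vec c$. Put $\kappa=1$ if the scheme is a GEDIRK scheme and $\kappa=0$ otherwise; put $\sigma=1$ if $A$ is invertible and the scheme is stiffly accurate (the last row of $A$ is $\vec b^{\,T}$),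 and $\sigma=0$ otherwise. **Theorem (Main Result for DIRK).** \begin{enumerate} \item If the WSO $q$ satisfies $q\le 2n_c-1$, then $$\left\lfloor\frac{q+\kappa}{2}\right\rfloor-\kappa+p\le s+1-\sigma .$$ In particular, if moreover $p=s-\sigma$, then $q\le 3$ if the scheme is not a GEDIRK scheme, and $q\le 4$ if it is. \item If $p=s+1-\sigma$, then (without any assumption on $n_c$) the WSO is at most $3$ if the scheme is not a GEDIRK scheme, and at most $4$ if it is. \end{enumerate} -/

import Mathlib

/-- An `s`-stage Runge-Kutta scheme, given by its Butcher matrix `A` and its weights `b`.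
The abscissas are always `c = A e` with `e = (1, …, 1)ᵀ`, see `RKScheme.c`. -/
structure RKScheme (s : ℕ) where
  A : Matrix (Fin s) (Fin s) ℝ
  b : Fin s → ℝ

namespace RKScheme

variable {s : ℕ}

/-- The abscissas `c = A e`, i.e. `c i = ∑ j, A i j`. -/
def c (M : RKScheme s) : Fin s → ℝ := fun i => ∑ j, M.A i j

/-- The number `n_c` of distinct abscissas. -/
noncomputable def numAbscissas (M : RKScheme s) : ℕ := (Finset.univ.image M.c).card

/-- Diagonally implicit scheme: `A` is lower triangular. -/
def IsDIRK (M : RKScheme s) : Prop := ∀ i j : Fin s, i < j → M.A i j = 0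

/-- Generalized EDIRK: a DIRK scheme for which `c` contains a zero and `a_ℓℓ = 0`, where `ℓ` is
the index of the first zero of `c`. -/
def IsGEDIRK (M : RKScheme s) : Prop :=
  M.IsDIRK ∧ ∃ l : Fin s, M.c l = 0 ∧ (∀ j : Fin s, j < l → M.c j ≠ 0) ∧ M.A l l = 0

/-- Stiffly accurate scheme: the last row of `A` equals `bᵀ`. -/
def IsStifflyAccurate (M : RKScheme s) : Prop :=
  ∃ l : Fin s, (l : ℕ) + 1 = s ∧ ∀ j : Fin s, M.A l j = M.b j

open Classical in
/-- `κ = 1` for GEDIRK schemes and `κ = 0` otherwise. -/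
noncomputable def kappa (M : RKScheme s) : ℕ := if M.IsGEDIRK then 1 else 0

open Classical in
/-- `σ = 1` if `A` is invertible and the scheme is stiffly accurate, and `σ = 0` otherwise. -/
noncomputable def sigma (M : RKScheme s) : ℕ :=
  if IsUnit M.A ∧ M.IsStifflyAccurate then 1 else 0

/-- The `k`-th stage order residual `τ⁽ᵏ⁾ = A c^(k-1) - c^k / k`, with componentwise powers
(used for `k ≥ 1` only). -/
noncomputable def tau (M : RKScheme s) (k : ℕ) : Fin s → ℝ :=
  fun i => (∑ j, M.A i j * M.c j ^ (k - 1)) - M.c i ^ k / k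

/-- The condition `S(ξ)`: `bᵀ A^j τ⁽ᵏ⁾ = 0` for `0 ≤ j ≤ s - 1` and `1 ≤ k ≤ ξ`. -/
def WSOCondition (M : RKScheme s) (ξ : ℕ) : Prop :=
  ∀ j k : ℕ, j < s → 1 ≤ k → k ≤ ξ → M.b ⬝ᵥ ((M.A ^ j).mulVec (M.tau k)) = 0

/-- The weak stage order: the largest `ξ` for which `S(ξ)` holds, and `∞` if `S(ξ)` holds for
all `ξ`. (`S(0)` is empty, and `S(ξ)` gets stronger as `ξ` grows.) -/
noncomputable def weakStageOrder (M : RKScheme s) : ℕ∞ :=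
  sSup {x : ℕ∞ | ∃ ξ : ℕ, x = (ξ : ℕ∞) ∧ M.WSOCondition ξ}

/-- The scheme has classical order (at least) `p`: for every smooth initial value problem
`u' = f(t, u)` in `ℝᵐ`, the error of a single step of size `h`, started on the exact solution at
`t₀`, is `O(h^(p+1))` as `h → 0⁺`.

Here `g h` are the stage values of the step of size `h`. For small `h` the stage equations have
exactly one solution near `(u t₀, …, u t₀)` (implicit function theorem), and the condition
`g h i → u t₀` says that this is the solution that the scheme uses. -/
def HasOrder (M : RKScheme s) (p : ℕ) : Prop :=
  ∀ (m : ℕ) (f : ℝ → EuclideanSpace ℝ (Fin m) → EuclideanSpace ℝ (Fin m))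
    (t₀ : ℝ) (u : ℝ → EuclideanSpace ℝ (Fin m))
    (g : ℝ → Fin s → EuclideanSpace ℝ (Fin m)),
    ContDiff ℝ ((⊤ : ℕ∞) : WithTop ℕ∞)
      (fun x : ℝ × EuclideanSpace ℝ (Fin m) => f x.1 x.2) →
    (∀ᶠ t in nhds t₀, HasDerivAt u (f t (u t)) t) →
    (∀ᶠ h in nhdsWithin (0 : ℝ) (Set.Ioi 0), ∀ i : Fin s,
      g h i = u t₀ + h • ∑ j, M.A i j • f (t₀ + M.c j * h) (g h j)) →
    (∀ i : Fin s,
      Filter.Tendsto (fun h => g h i) (nhdsWithin (0 : ℝ) (Set.Ioi 0)) (nhds (u t₀))) →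
    Asymptotics.IsBigO (nhdsWithin (0 : ℝ) (Set.Ioi 0))
      (fun h : ℝ => (u t₀ + h • ∑ j, M.b j • f (t₀ + M.c j * h) (g h j)) - u (t₀ + h))
      (fun h : ℝ => h ^ (p + 1))

end RKScheme

/-! Let `W = M.unobservable` be the space of all `v` with `bᵀ A^j v = 0` for every `j`. Two opposite
bounds on `dim W` give the theorem.

Upper bound, `p + dim W + σ ≤ s + 1` (`order_add_finrank_le`). The test equation `u' = u` yields `bᵀ
A^i e = 1/(i+1)!` for `i < p`. The minimal polynomial `χ` of `A` on `ℝˢ / W` has degree `d ≤ s - dim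
W`, and its roots are real because `A` is triangular. As `χ(A) e ∈ W`, the coefficients of `exp(z)
z^d χ(1/z)` of order `d+1, …, p` vanish, and that of order `d` too if `σ = 1`. Two consecutive ones
cannot vanish: up to the factor `n!` the `n`-th is the value at `0` of `(1 + D)^n Q`, with `Q` the
reverse of `χ`. Since `1 + D` preserves real-rootedness and creates no new double roots, a double
root at `0` would descend to `Q(0) = 0`, whereas `Q(0) = 1`.

Lower bound, `⌊(q + κ)/2⌋ ≤ dim W + κ` (`half_weakStageOrder_le`). Weak stage order `q` puts `A
π'(c) - π(c)` in `W` for every `π` of degree at most `q` with `π(0) = 0`. Taking `π` with double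
zeros at the other abscissas of an initial block of stages gives a triangular, hence independent,
family in `W`.

If `p = s + 1 - σ`, then `W = 0`, and weak stage order `3` would force `c = 0`, contradicting the
order conditions. -/

namespace Polynomial

/-! ### Real-rooted polynomials and the operator `1 + D` -/

theorem Splits.laguerre_nonneg {P : ℝ[X]} (hP : P.Splits) (x : ℝ) :
    0 ≤ P.derivative.eval x ^ 2 - P.eval x * P.derivative.derivative.eval x := by
  induction hn : P.natDegree generalizing P with
  | zero =>
    rw [eq_C_of_natDegree_eq_zero hn]
    simp
  | succ n ih =>
    have hdeg : P.degree ≠ 0 := fun h => by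
      rw [natDegree_eq_of_degree_eq_some h] at hn; simp at hn
    obtain ⟨r, hr⟩ := hP.exists_eval_eq_zero hdeg
    obtain ⟨R, rfl⟩ := dvd_iff_isRoot.2 hr
    have hR : R.Splits := (splits_X_sub_C_mul_iff).1 hP
    have hR0 : R ≠ 0 := by rintro rfl; simp at hn
    have := ih hR (by rw [natDegree_mul (X_sub_C_ne_zero r) hR0, natDegree_X_sub_C] at hn; omega)
    simp only [derivative_mul, derivative_add, derivative_sub, derivative_X, derivative_C, eval_add,
      eval_mul, eval_sub, eval_X, eval_C, sub_zero, one_mul]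
    -- For `P = (X - r) R`: `P'² - P P'' = R² + (x - r)² (R'² - R R'')`.
    have h2 := mul_nonneg (sq_nonneg (x - r)) this
    nlinarith [sq_nonneg (R.eval x)]

theorem Splits.laguerre_pos {P : ℝ[X]} (hP : P.Splits) (hn : P.natDegree ≠ 0) {x : ℝ}
    (hx : P.eval x ≠ 0) :
    0 < P.derivative.eval x ^ 2 - P.eval x * P.derivative.derivative.eval x := by
  have hdeg : P.degree ≠ 0 := fun h => hn (natDegree_eq_of_degree_eq_some h)
  obtain ⟨r, hr⟩ := hP.exists_eval_eq_zero hdeg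
  obtain ⟨R, rfl⟩ := dvd_iff_isRoot.2 hr
  have hR : R.Splits := (splits_X_sub_C_mul_iff).1 hP
  have hRx : R.eval x ≠ 0 := fun h => hx (by simp [h])
  have := hR.laguerre_nonneg x
  simp only [derivative_mul, derivative_add, derivative_sub, derivative_X, derivative_C, eval_add,
    eval_mul, eval_sub, eval_X, eval_C, sub_zero, one_mul]
  have h2 := mul_nonneg (sq_nonneg (x - r)) this
  have h3 : 0 < R.eval x ^ 2 := by positivity
  nlinarith

/-- A double root of `P + P'` is a double root of `P`, if `P` is real-rooted. -/
theorem Splits.double_root_of_add_derivative {P : ℝ[X]} (hP : P.Splits) {x : ℝ}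
    (h0 : (P + derivative P).eval x = 0)
    (h1 : (derivative (P + derivative P)).eval x = 0) :
    P.eval x = 0 ∧ (derivative P).eval x = 0 := by
  simp only [derivative_add, eval_add] at h0 h1
  by_cases hx : P.eval x = 0
  · exact ⟨hx, by linarith⟩
  · exfalso
    by_cases hn : P.natDegree = 0
    · rw [eq_C_of_natDegree_eq_zero hn] at h0 hx
      simp at h0 hx
      exact hx h0
    · have := hP.laguerre_pos hn hx
      -- Here `P' = -P` and `P'' = P` at `x`, so the Laguerre expression is zero, against its strict
      -- positivity.
      have e1 : (derivative P).eval x = - P.eval x := by linarith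
      have e2 : (derivative (derivative P)).eval x = P.eval x := by linarith
      rw [e1, e2] at this
      nlinarith

theorem add_derivative_ne_zero {P : ℝ[X]} (hP0 : P ≠ 0) : P + derivative P ≠ 0 := by
  intro h
  by_cases hn : P.natDegree = 0
  · rw [eq_C_of_natDegree_eq_zero hn] at h hP0
    simp at h hP0
    exact hP0 h
  · have h1 : P = - derivative P := by linear_combination h
    have h2 := natDegree_derivative_lt hn
    have h3 : P.natDegree = (derivative P).natDegree := by
      conv_lhs => rw [h1]
      exact natDegree_neg _
    omega

/-- At a non-real root `z` of `P + P'` the logarithmic derivative `∑ 1/(z - r)` equals `-1`. But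
with all `r` real, each term has imaginary part of sign opposite to `Im z`, so the sum is not real;
an empty sum is `0`. -/
theorem Splits.add_derivative {P : ℝ[X]} (hP : P.Splits) (hP0 : P ≠ 0) :
    (P + derivative P).Splits := by
  have hinj : Function.Injective (algebraMap ℝ ℂ) := (algebraMap ℝ ℂ).injective
  refine Splits.of_splits_map_of_injective hinj (IsAlgClosed.splits _) ?_
  intro z hz
  rw [mem_roots ((Polynomial.map_ne_zero_iff hinj).2 (add_derivative_ne_zero hP0))] at hz
  by_contra hzr
  have him : z.im ≠ 0 := fun h => hzr ⟨z.re, by apply Complex.ext <;> simp [h]⟩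
  have hPz : (P.map (algebraMap ℝ ℂ)).eval z ≠ 0 := by
    intro h
    have hroot : (P.map (algebraMap ℝ ℂ)).IsRoot z := h
    exact hzr (hP.mem_range_of_isRoot hP0 hroot)
  have hS : (P.map (algebraMap ℝ ℂ)).Splits := IsAlgClosed.splits _
  have key := hS.eval_derivative_div_eval_of_ne_zero hPz
  have hm1 : (P.map (algebraMap ℝ ℂ)).derivative.eval z / (P.map (algebraMap ℝ ℂ)).eval z = -1 := by
    rw [IsRoot.def, Polynomial.map_add, ← derivative_map, eval_add] at hz
    rw [div_eq_iff hPz]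
    linear_combination hz
  rw [hm1, hP.roots_map, Multiset.map_map] at key
  -- The witness is `t = ∑ |z - r|⁻²`.
  have hre : ∀ m : Multiset ℝ, ∃ t : ℝ, 0 ≤ t ∧ (m ≠ 0 → 0 < t) ∧
      ((m.map ((fun w => 1 / (z - w)) ∘ (algebraMap ℝ ℂ))).sum).im = - t * z.im := by
    intro m
    induction m using Multiset.induction with
    | empty => exact ⟨0, le_rfl, by simp, by simp⟩
    | cons r m ih =>
      obtain ⟨t, ht, -, hs⟩ := ih
      have hne : z - (r : ℂ) ≠ 0 := fun h => him (by
        have := congrArg Complex.im h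
        simpa using this)
      have hpos : 0 < Complex.normSq (z - (r : ℂ)) := Complex.normSq_pos.2 hne
      refine ⟨t + (Complex.normSq (z - (r : ℂ)))⁻¹, by positivity, fun _ => by positivity, ?_⟩
      rw [Multiset.map_cons, Multiset.sum_cons, Complex.add_im, hs]
      simp [Complex.inv_im]
      ring
  obtain ⟨t, -, ht, hs⟩ := hre P.roots
  rw [← key] at hs
  by_cases hr : P.roots = 0
  · rw [hr] at key
    simp at key
  · have := ht hr
    simp at hs
    rcases hs with h | h
    · exact this.ne' h
    · exact him h

theorem Splits.iterate_add_derivative {P : ℝ[X]} (hP : P.Splits) (hP0 : P ≠ 0) (n : ℕ) :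
    (((fun R : ℝ[X] => R + derivative R)^[n]) P).Splits ∧
      ((fun R : ℝ[X] => R + derivative R)^[n]) P ≠ 0 := by
  induction n with
  | zero => exact ⟨hP, hP0⟩
  | succ n ih =>
    rw [Function.iterate_succ_apply']
    exact ⟨ih.1.add_derivative ih.2, add_derivative_ne_zero ih.2⟩

theorem Splits.root_of_double_root_iterate {P : ℝ[X]} (hP : P.Splits) (hP0 : P ≠ 0) (n : ℕ) {x : ℝ}
    (h0 : (((fun R : ℝ[X] => R + derivative R)^[n]) P).eval x = 0)
    (h1 : (derivative (((fun R : ℝ[X] => R + derivative R)^[n]) P)).eval x = 0) :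
    P.eval x = 0 := by
  induction n with
  | zero => exact h0
  | succ n ih =>
    rw [Function.iterate_succ_apply'] at h0 h1
    have h := hP.iterate_add_derivative hP0 n
    have := h.1.double_root_of_add_derivative h0 h1
    exact ih this.1 this.2

/-- Binomial expansion of `(1 + D)^n`: the `j`-th derivative at `0` is `j! P_j`, and `j!` times the
binomial coefficient is the descending factorial. -/
theorem coeff_zero_iterate_add_derivative (P : ℝ[X]) (n : ℕ) {N : ℕ} (hN : P.natDegree < N) :
    (((fun R : ℝ[X] => R + derivative R)^[n]) P).coeff 0 =
      ∑ j ∈ Finset.range N, P.coeff j * (n.descFactorial j : ℝ) := by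
  induction n generalizing P with
  | zero =>
    rw [Finset.sum_eq_single 0]
    · simp
    · intro j _ hj
      obtain ⟨j, rfl⟩ := Nat.exists_eq_succ_of_ne_zero hj
      simp
    · intro h
      exact absurd (Finset.mem_range.2 (by omega)) h
  | succ n ih =>
    obtain ⟨N, rfl⟩ : ∃ k, N = k + 1 := ⟨N - 1, by omega⟩
    rw [Function.iterate_succ_apply, ih]
    · simp only [coeff_add, coeff_derivative, add_mul, Finset.sum_add_distrib]
      rw [Finset.sum_range_succ (fun j => P.coeff (j + 1) * ((j : ℝ) + 1) * (n.descFactorial j : ℝ)),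
        Finset.sum_range_succ' (fun j => P.coeff j * ((n + 1).descFactorial j : ℝ)),
        Finset.sum_range_succ' (fun j => P.coeff j * (n.descFactorial j : ℝ)),
        coeff_eq_zero_of_natDegree_lt hN]
      have : ∀ j, ((n + 1).descFactorial (j + 1) : ℝ)
          = (n.descFactorial (j + 1) : ℝ) + ((j : ℝ) + 1) * (n.descFactorial j : ℝ) := by
        intro j
        rw [Nat.succ_descFactorial_succ, Nat.descFactorial_succ]
        by_cases hj : j ≤ n
        · push_cast [Nat.cast_sub hj]; ring
        · rw [Nat.descFactorial_eq_zero_iff_lt.2 (by omega)]; simp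
      have hs : ∀ j, P.coeff (j + 1) * ((n + 1).descFactorial (j + 1) : ℝ)
          = P.coeff (j + 1) * (n.descFactorial (j + 1) : ℝ)
            + P.coeff (j + 1) * ((j : ℝ) + 1) * (n.descFactorial j : ℝ) := by
        intro j; rw [this]; ring
      simp only [hs, Finset.sum_add_distrib, Nat.descFactorial_zero]
      ring
    · refine lt_of_le_of_lt (natDegree_add_le _ _) (max_lt hN ?_)
      exact lt_of_le_of_lt (natDegree_derivative_le P) (by omega)

theorem splits_reverse {P : ℝ[X]} (hP : P.Splits) : P.reverse.Splits := by
  rw [hP.eq_prod_roots, reverse_mul_of_domain, reverse_C]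
  refine Splits.C_mul ?_ _
  induction P.roots using Multiset.induction with
  | empty => simp only [Multiset.map_zero, Multiset.prod_zero, ← C_1, reverse_C]; exact Splits.C _
  | cons r m ih =>
    rw [Multiset.map_cons, Multiset.prod_cons, reverse_mul_of_domain]
    refine Splits.mul (Splits.of_natDegree_le_one ?_) ih
    exact (reverse_natDegree_le _).trans (natDegree_X_sub_C_le r)

/-- If `χ` is monic and real-rooted of degree `d`, two consecutive coefficients of order `n ≥ d` of
`exp(z) z^d χ(1/z)` cannot both vanish. -/
theorem not_consecutive_exp_coeff_eq_zero {χ : ℝ[X]} (hm : χ.Monic) (hχ : χ.Splits) {n : ℕ}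
    (hn : χ.natDegree ≤ n)
    (h0 : ∑ m ∈ Finset.range (χ.natDegree + 1),
      χ.coeff m / ((n - χ.natDegree + m).factorial : ℝ) = 0)
    (h1 : ∑ m ∈ Finset.range (χ.natDegree + 1),
      χ.coeff m / ((n + 1 - χ.natDegree + m).factorial : ℝ) = 0) : False := by
  have hQ0 : χ.reverse.coeff 0 = 1 := by rw [coeff_zero_reverse]; exact hm
  have hne : χ.reverse ≠ 0 := fun h => by rw [h] at hQ0; simp at hQ0
  have hlt : χ.reverse.natDegree < χ.natDegree + 1 := by have := reverse_natDegree_le χ; omega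
  -- The sum times `k!` is the constant term of `(1 + D)^k` applied to the reverse of `χ`.
  have key : ∀ k, χ.natDegree ≤ k → ∑ m ∈ Finset.range (χ.natDegree + 1),
      χ.coeff m / ((k - χ.natDegree + m).factorial : ℝ) = 0 →
      (((fun R : ℝ[X] => R + derivative R)^[k]) χ.reverse).eval 0 = 0 := by
    intro k hk h
    rw [← coeff_zero_eq_eval_zero, coeff_zero_iterate_add_derivative _ _ hlt,
      ← Finset.sum_range_reflect]
    have : ∑ m ∈ Finset.range (χ.natDegree + 1),
      χ.coeff m / ((k - χ.natDegree + m).factorial : ℝ) * (k.factorial : ℝ) = 0 := by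
      rw [← Finset.sum_mul, h, zero_mul]
    rw [← this]
    refine Finset.sum_congr rfl fun m hm' => ?_
    have hm'' : m ≤ χ.natDegree := by simpa [Nat.lt_succ_iff] using hm'
    rw [coeff_reverse, revAt_le (by omega),
      show χ.natDegree - (χ.natDegree + 1 - 1 - m) = m by omega, div_mul_eq_mul_div, mul_div_assoc,
      ← Nat.factorial_mul_descFactorial (show χ.natDegree + 1 - 1 - m ≤ k by omega),
      show k - (χ.natDegree + 1 - 1 - m) = k - χ.natDegree + m by omega]
    push_cast
    rw [mul_div_cancel_left₀]
    exact_mod_cast (Nat.factorial_pos _).ne'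
  have e0 := key n hn h0
  have e1 := key (n + 1) (by omega) h1
  rw [Function.iterate_succ_apply', eval_add, e0, zero_add] at e1
  have := (splits_reverse hχ).root_of_double_root_iterate hne n e0 e1
  rw [← coeff_zero_eq_eval_zero, hQ0] at this
  exact one_ne_zero this

/-- A polynomial of degree at most `p` that is `O(h^(p+1))` at `0⁺` vanishes. -/
theorem eq_zero_of_isBigO_pow {P : ℝ[X]} {p : ℕ} (hd : P.natDegree ≤ p)
    (hO : (fun h : ℝ => P.eval h) =O[nhdsWithin (0 : ℝ) (Set.Ioi 0)] (fun h : ℝ => h ^ (p + 1))) :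
    P = 0 := by
  by_contra hP
  obtain ⟨R, hR, hnd⟩ := exists_eq_pow_rootMultiplicity_mul_and_not_dvd P hP 0
  have hk : P.rootMultiplicity 0 ≤ p := by
    refine le_trans ?_ hd
    have h := natDegree_le_of_dvd (pow_rootMultiplicity_dvd P 0) hP
    rwa [natDegree_pow, natDegree_X_sub_C, mul_one] at h
  set k := P.rootMultiplicity 0
  have hR0 : R.eval 0 ≠ 0 := fun h => hnd (dvd_iff_isRoot.2 h)
  -- Dividing by `h^k` leaves a positive power of `h` on the right, so `R` would tend to `0`,
  -- whereas `R(0) ≠ 0`.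
  have h1 : (fun h : ℝ => R.eval h) =O[nhdsWithin (0 : ℝ) (Set.Ioi 0)]
      (fun h : ℝ => h ^ (p + 1 - k)) := by
    have h2 := hO.mul (Asymptotics.isBigO_refl (fun h : ℝ => (h ^ k)⁻¹)
      (nhdsWithin (0 : ℝ) (Set.Ioi 0)))
    refine h2.congr' ?_ ?_
    · filter_upwards [self_mem_nhdsWithin] with h hh
      have : h ≠ 0 := ne_of_gt hh
      rw [hR]
      simp only [eval_mul, eval_pow, eval_sub, eval_X, eval_C, sub_zero]
      field_simp
    · filter_upwards [self_mem_nhdsWithin] with h hh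
      have : h ≠ 0 := ne_of_gt hh
      rw [← div_eq_mul_inv, pow_sub₀ _ this (by omega), div_eq_mul_inv]
  have ht : Filter.Tendsto (fun h : ℝ => h ^ (p + 1 - k)) (nhdsWithin (0 : ℝ) (Set.Ioi 0))
      (nhds 0) := by
    have : Filter.Tendsto (fun h : ℝ => h ^ (p + 1 - k)) (nhds 0) (nhds (0 ^ (p + 1 - k))) :=
      (continuous_pow _).tendsto 0
    rw [zero_pow (by omega)] at this
    exact this.mono_left nhdsWithin_le_nhds
  have h3 := h1.trans_tendsto ht
  have h4 : Filter.Tendsto (fun h : ℝ => R.eval h) (nhdsWithin (0 : ℝ) (Set.Ioi 0))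
      (nhds (R.eval 0)) := (R.continuous.tendsto 0).mono_left nhdsWithin_le_nhds
  exact hR0 (tendsto_nhds_unique h4 h3)

end Polynomial

/-! ### Order conditions from the test equation -/

namespace RKScheme

open Polynomial in
/-- The order conditions `bᵀ A^i e = 1 / (i + 1)!`, `i < p`, from the test equation `u' = u`. -/
theorem HasOrder.tall_tree_condition {s : ℕ} {M : RKScheme s} {p : ℕ} (hp : M.HasOrder p) {i : ℕ}
    (hi : i < p) : M.b ⬝ᵥ ((M.A ^ i).mulVec 1) = 1 / ((i + 1).factorial : ℝ) := by
  set B : ℝ → Matrix (Fin s) (Fin s) ℝ := fun h => 1 - h • M.A with hB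
  have hBc : Continuous B := by fun_prop
  have hdet : Continuous fun h => (B h).det := hBc.matrix_det
  have hdet0 : (B 0).det = 1 := by simp [hB]
  -- Cramer's formula for `(1 - hA)⁻¹ e`, whose continuity at `h = 0` is evident.
  set γ : ℝ → Fin s → ℝ := fun h => ((B h).det)⁻¹ • ((B h).adjugate).mulVec 1 with hγ
  have hγ0 : γ 0 = 1 := by simp [hγ, hB]
  have hγc : Filter.Tendsto γ (nhdsWithin 0 (Set.Ioi 0)) (nhds 1) := by
    have : ContinuousAt γ 0 := by
      refine ContinuousAt.smul (hdet.continuousAt.inv₀ (by rw [hdet0]; exact one_ne_zero)) ?_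
      exact (hBc.matrix_adjugate.matrix_mulVec continuous_const).continuousAt
    rw [ContinuousAt, hγ0] at this
    exact this.mono_left nhdsWithin_le_nhds
  have hne : ∀ᶠ h in nhdsWithin (0 : ℝ) (Set.Ioi 0), (B h).det ≠ 0 := by
    have : ∀ᶠ h in nhds (0 : ℝ), (B h).det ≠ 0 :=
      hdet.continuousAt.eventually_ne (by rw [hdet0]; exact one_ne_zero)
    exact this.filter_mono nhdsWithin_le_nhds
  have hγeq : ∀ᶠ h in nhdsWithin (0 : ℝ) (Set.Ioi 0), γ h = 1 + h • M.A.mulVec (γ h) := by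
    filter_upwards [hne] with h hh
    have h1 : (B h).mulVec (γ h) = 1 := by
      rw [hγ]
      simp only
      rw [Matrix.mulVec_smul, Matrix.mulVec_mulVec, Matrix.mul_adjugate, Matrix.smul_mulVec,
        Matrix.one_mulVec, smul_smul, inv_mul_cancel₀ hh, one_smul]
    have h2 : (B h).mulVec (γ h) = γ h - h • M.A.mulVec (γ h) := by
      rw [hB]
      simp only
      rw [Matrix.sub_mulVec, Matrix.one_mulVec, Matrix.smul_mulVec]
    rw [← h1, h2]; abel
  -- the Neumann expansion of the stage values
  have hexp : ∀ᶠ h in nhdsWithin (0 : ℝ) (Set.Ioi 0), M.b ⬝ᵥ γ h =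
      ∑ j ∈ Finset.range p, (M.b ⬝ᵥ ((M.A ^ j).mulVec 1)) * h ^ j
        + h ^ p * (M.b ⬝ᵥ ((M.A ^ p).mulVec (γ h))) := by
    filter_upwards [hγeq] with h hh
    have : ∀ n : ℕ, M.b ⬝ᵥ γ h =
      ∑ j ∈ Finset.range n, (M.b ⬝ᵥ ((M.A ^ j).mulVec 1)) * h ^ j
        + h ^ n * (M.b ⬝ᵥ ((M.A ^ n).mulVec (γ h))) := by
      intro n
      induction n with
      | zero => simp
      | succ n ih =>
        rw [ih, Finset.sum_range_succ]
        conv_lhs => rw [hh]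
        rw [Matrix.mulVec_add, dotProduct_add, Matrix.mulVec_smul, dotProduct_smul,
          Matrix.mulVec_mulVec, ← pow_succ, smul_eq_mul]
        ring
    exact this p
  set e : EuclideanSpace ℝ (Fin 1) := EuclideanSpace.single 0 1 with he
  have hO := hp 1 (fun _ x => x) 0 (fun t => Real.exp t • e) (fun h i => γ h i • e) contDiff_snd
    (Filter.Eventually.of_forall fun t => (Real.hasDerivAt_exp t).smul_const e)
    (by
      filter_upwards [hγeq] with h hh i
      have h1 : γ h i = 1 + h * ∑ j, M.A i j * γ h j := congrFun hh i
      rw [Real.exp_zero]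
      simp only [smul_smul]
      rw [← Finset.sum_smul, smul_smul, ← add_smul, ← h1])
    (fun i => by
      have h1 := ((tendsto_pi_nhds.1 hγc) i).smul_const e
      simpa using h1)
  have hO1 : (fun h : ℝ => 1 + h * (M.b ⬝ᵥ γ h) - Real.exp h)
      =O[nhdsWithin (0 : ℝ) (Set.Ioi 0)] (fun h : ℝ => h ^ (p + 1)) := by
    refine (hO.norm_left.congr_left fun h => ?_).of_norm_left
    have h1 : Real.exp 0 • e + h • ∑ j, M.b j • γ h j • e - Real.exp (0 + h) • e
        = (1 + h * (M.b ⬝ᵥ γ h) - Real.exp h) • e := by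
      simp only [smul_smul]
      rw [← Finset.sum_smul, smul_smul, ← add_smul, ← sub_smul, Real.exp_zero, zero_add]
      rfl
    rw [h1, norm_smul, he]; simp
  have hO2 := (Real.exp_sub_sum_range_isBigO_pow (p + 1)).mono
    (nhdsWithin_le_nhds : nhdsWithin (0 : ℝ) (Set.Ioi 0) ≤ nhds 0)
  have hO3 : (fun h : ℝ => h ^ (p + 1) * (M.b ⬝ᵥ ((M.A ^ p).mulVec (γ h))))
      =O[nhdsWithin (0 : ℝ) (Set.Ioi 0)] (fun h : ℝ => h ^ (p + 1)) := by
    have hb : Filter.Tendsto (fun h => M.b ⬝ᵥ ((M.A ^ p).mulVec (γ h)))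
        (nhdsWithin (0 : ℝ) (Set.Ioi 0)) (nhds (M.b ⬝ᵥ ((M.A ^ p).mulVec 1))) := by
      have hc : Continuous fun v : Fin s → ℝ => M.b ⬝ᵥ ((M.A ^ p).mulVec v) :=
        continuous_const.dotProduct (continuous_const.matrix_mulVec continuous_id)
      exact (hc.tendsto 1).comp hγc
    simpa using (Asymptotics.isBigO_refl (fun h : ℝ => h ^ (p + 1)) _).mul (hb.isBigO_one ℝ)
  -- The terms of degree at most `p` in the one-step error; everything else is `O(h^(p+1))`.
  set P : ℝ[X] := ∑ j ∈ Finset.range p,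
    monomial (j + 1) (M.b ⬝ᵥ ((M.A ^ j).mulVec 1) - 1 / ((j + 1).factorial : ℝ)) with hP
  have hP0 : P = 0 := by
    refine eq_zero_of_isBigO_pow (p := p) (natDegree_sum_le_of_forall_le _ _ fun j hj => ?_) ?_
    · exact (natDegree_monomial_le _).trans (Finset.mem_range.1 hj)
    · refine ((hO1.add hO2).sub hO3).congr' ?_ Filter.EventuallyEq.rfl
      filter_upwards [hexp] with h hh
      rw [hh, hP, eval_finsetSum, Finset.sum_range_succ']
      simp only [eval_monomial, sub_mul, Finset.sum_sub_distrib, mul_add, Finset.mul_sum]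
      have e1 : ∀ j, h * ((M.b ⬝ᵥ ((M.A ^ j).mulVec 1)) * h ^ j)
        = (M.b ⬝ᵥ ((M.A ^ j).mulVec 1)) * h ^ (j + 1) := fun j => by ring
      have e2 : ∀ j : ℕ, h ^ (j + 1) / ((j + 1).factorial : ℝ)
        = 1 / ((j + 1).factorial : ℝ) * h ^ (j + 1) := fun j => by ring
      simp only [e1, e2, pow_zero, Nat.factorial_zero, Nat.cast_one]
      ring
  have := congrArg (fun R => coeff R (i + 1)) hP0
  simp only [hP, finsetSum_coeff, coeff_monomial, add_left_inj, coeff_zero] at this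
  rw [Finset.sum_ite_eq' , if_pos (Finset.mem_range.2 hi)] at this
  linarith

end RKScheme

/-! ### The unobservable space and the order barrier -/

namespace RKScheme

/-- The vectors `v` with `bᵀ A^j v = 0` for all `j`. -/
def unobservable {s : ℕ} (M : RKScheme s) : Submodule ℝ (Fin s → ℝ) where
  carrier := {v | ∀ j : ℕ, M.b ⬝ᵥ ((M.A ^ j).mulVec v) = 0}
  add_mem' := fun {v w} hv hw j => by rw [Matrix.mulVec_add, dotProduct_add, hv j, hw j, add_zero]
  zero_mem' := fun j => by simp
  smul_mem' := fun r v hv j => by rw [Matrix.mulVec_smul, dotProduct_smul, hv j, smul_zero]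

variable {s : ℕ} {M : RKScheme s}

theorem mem_unobservable {v : Fin s → ℝ} :
    v ∈ M.unobservable ↔ ∀ j : ℕ, M.b ⬝ᵥ ((M.A ^ j).mulVec v) = 0 := Iff.rfl

/-- By Cayley-Hamilton it suffices to consider `j < s`. -/
theorem mem_unobservable_of_lt {v : Fin s → ℝ}
    (h : ∀ j < s, M.b ⬝ᵥ ((M.A ^ j).mulVec v) = 0) : v ∈ M.unobservable := by
  intro j
  rcases Nat.eq_zero_or_pos s with rfl | hs
  · simp [dotProduct]
  have hdeg : (Polynomial.X ^ j %ₘ M.A.charpoly).natDegree < s := by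
    have hne : M.A.charpoly ≠ 1 := fun h1 => by
      have := M.A.charpoly_natDegree_eq_dim
      rw [h1, Polynomial.natDegree_one, Fintype.card_fin] at this
      omega
    have := Polynomial.natDegree_modByMonic_lt (Polynomial.X ^ j) M.A.charpoly_monic hne
    rwa [M.A.charpoly_natDegree_eq_dim, Fintype.card_fin] at this
  rw [Matrix.pow_eq_aeval_mod_charpoly, Polynomial.aeval_eq_sum_range, Matrix.sum_mulVec,
    dotProduct_sum]
  refine Finset.sum_eq_zero fun i hi => ?_
  rw [Matrix.smul_mulVec, dotProduct_smul, h i (by have := Finset.mem_range.1 hi; omega),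
    smul_zero]

theorem mulVec_mem_unobservable {v : Fin s → ℝ} (hv : v ∈ M.unobservable) :
    M.A.mulVec v ∈ M.unobservable := fun j => by
  rw [Matrix.mulVec_mulVec, ← pow_succ]; exact hv (j + 1)

theorem IsDIRK.charpoly_splits (hM : M.IsDIRK) : M.A.charpoly.Splits := by
  have : M.A.transpose.IsUpperTriangular := fun i j hij => hM j i hij
  rw [← Matrix.charpoly_transpose, Matrix.charpoly_of_isUpperTriangular _ this]
  exact Polynomial.Splits.prod fun i _ => Polynomial.Splits.X_sub_C _

/-- A monic real-rooted polynomial of degree at most `codim unobservable` that maps everything to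
the unobservable space. -/
theorem IsDIRK.exists_annihilator (hM : M.IsDIRK) : ∃ χ : Polynomial ℝ, χ.Monic ∧ χ.Splits ∧
    χ.natDegree + Module.finrank ℝ M.unobservable ≤ s ∧
    ∀ v, (Polynomial.aeval M.A χ).mulVec v ∈ M.unobservable := by
  set f := M.A.toLin' with hf
  have hinv : M.unobservable ≤ M.unobservable.comap f := fun v hv => mulVec_mem_unobservable hv
  set g := M.unobservable.mapQ M.unobservable f hinv with hg
  have hq : ∀ (χ : Polynomial ℝ) (v : Fin s → ℝ),
      Polynomial.aeval g χ (Submodule.Quotient.mk v)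
        = Submodule.Quotient.mk ((Polynomial.aeval M.A χ).mulVec v) := by
    have hpow : ∀ (n : ℕ) (v : Fin s → ℝ), (g ^ n) (Submodule.Quotient.mk v)
        = Submodule.Quotient.mk ((M.A ^ n).mulVec v) := by
      intro n
      induction n with
      | zero => intro v; simp
      | succ n ih =>
        intro v
        rw [pow_succ, Module.End.mul_apply, hg, Submodule.mapQ_apply, ← hg, ih, hf,
          Matrix.toLin'_apply, Matrix.mulVec_mulVec, ← pow_succ]
    intro χ v
    rw [Polynomial.aeval_eq_sum_range, Polynomial.aeval_eq_sum_range, Matrix.sum_mulVec,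
      LinearMap.sum_apply, ← Submodule.mkQ_apply, ← Submodule.mkQ_apply, map_sum]
    refine Finset.sum_congr rfl fun i _ => ?_
    rw [LinearMap.smul_apply, Submodule.mkQ_apply, hpow, Matrix.smul_mulVec, map_smul,
      Submodule.mkQ_apply]
  -- The minimal polynomial on the quotient divides the characteristic polynomial of `A`, hence
  -- splits; its degree is at most the dimension of the quotient.
  refine ⟨minpoly ℝ g, minpoly.monic (Algebra.IsIntegral.isIntegral g), ?_, ?_, ?_⟩
  · refine hM.charpoly_splits.of_dvd M.A.charpoly_monic.ne_zero (minpoly.dvd _ _ ?_)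
    refine LinearMap.ext fun x => ?_
    obtain ⟨v, rfl⟩ := Submodule.Quotient.mk_surjective _ x
    rw [hq, Matrix.aeval_self_charpoly, Matrix.zero_mulVec]
    rfl
  · have h1 := Polynomial.natDegree_le_of_dvd (LinearMap.minpoly_dvd_charpoly g)
      g.charpoly_monic.ne_zero
    rw [LinearMap.charpoly_natDegree] at h1
    have h2 := M.unobservable.finrank_quotient_add_finrank
    rw [Module.finrank_fin_fun] at h2
    omega
  · intro v
    rw [← Submodule.Quotient.mk_eq_zero, ← hq, minpoly.aeval]
    rfl

theorem sum_coeff_mul_dotProduct_pow (χ : Polynomial ℝ) (v : Fin s → ℝ) (j : ℕ) :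
    ∑ m ∈ Finset.range (χ.natDegree + 1), χ.coeff m * (M.b ⬝ᵥ ((M.A ^ (j + m)).mulVec v))
      = M.b ⬝ᵥ ((M.A ^ j).mulVec ((Polynomial.aeval M.A χ).mulVec v)) := by
  rw [Polynomial.aeval_eq_sum_range, Matrix.sum_mulVec, Matrix.mulVec_sum, dotProduct_sum]
  refine Finset.sum_congr rfl fun i _ => ?_
  rw [Matrix.smul_mulVec, Matrix.mulVec_smul, dotProduct_smul, Matrix.mulVec_mulVec, pow_add,
    smul_eq_mul]

/-- The order barrier `p ≤ codim unobservable + 1 - σ`. -/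
theorem IsDIRK.order_add_finrank_le (hM : M.IsDIRK) {p : ℕ}
    (hp : ∀ i < p, M.b ⬝ᵥ ((M.A ^ i).mulVec 1) = 1 / ((i + 1).factorial : ℝ)) :
    p + Module.finrank ℝ M.unobservable + M.sigma ≤ s + 1 := by
  obtain ⟨χ, hmon, hspl, hdeg, hχ⟩ := hM.exists_annihilator
  by_contra hlt
  -- Pair `χ(A) e ∈ W` with `bᵀ A^(n-d-1)`. The powers of `A` that occur are at most `n - 1 < p`, so
  -- the order conditions apply.
  have hvan : ∀ n, χ.natDegree < n → n ≤ p → ∑ m ∈ Finset.range (χ.natDegree + 1),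
      χ.coeff m / ((n - χ.natDegree + m).factorial : ℝ) = 0 := by
    intro n hn hnp
    have h := (sum_coeff_mul_dotProduct_pow (M := M) χ 1 (n - χ.natDegree - 1)).trans (hχ 1 _)
    rw [← h]
    refine Finset.sum_congr rfl fun m hm => ?_
    have := Finset.mem_range.1 hm
    rw [hp _ (by omega), show n - χ.natDegree - 1 + m + 1 = n - χ.natDegree + m by omega,
      mul_one_div]
  by_cases hσ : IsUnit M.A ∧ M.IsStifflyAccurate
  · have h1 : M.sigma = 1 := if_pos hσ
    obtain ⟨hU, l, -, hl⟩ := hσ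
    have hUd := (Matrix.isUnit_iff_isUnit_det _).1 hU
    have hb : M.b = Matrix.vecMul (Pi.single l 1) M.A := by
      ext j; simp [hl]
    -- `bᵀ A⁻¹ v` is the last entry of `v`
    have hbinv : ∀ v, M.b ⬝ᵥ (M.A⁻¹.mulVec v) = v l := by
      intro v
      rw [hb, ← Matrix.dotProduct_mulVec, Matrix.mulVec_mulVec, Matrix.mul_nonsing_inv _ hUd]
      simp
    -- `A` is injective on the finite-dimensional space `W`, hence onto: `v = A w` with `w ∈ W`, and
    -- `v l = bᵀ w = 0`.
    have hinv : ∀ v ∈ M.unobservable, v l = 0 := by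
      intro v hv
      set r := (M.A.toLin').restrict
        (p := M.unobservable) (q := M.unobservable) fun w hw => mulVec_mem_unobservable hw
      have hr : Function.Injective r := by
        intro x y hxy
        have h := congrArg Subtype.val hxy
        exact Subtype.ext (Matrix.mulVec_injective_of_isUnit hU h)
      obtain ⟨w, hw⟩ := LinearMap.injective_iff_surjective.1 hr ⟨v, hv⟩
      have h : M.A.mulVec w = v := congrArg Subtype.val hw
      have h0 := w.2 0
      rw [pow_zero, Matrix.one_mulVec, hb, ← Matrix.dotProduct_mulVec, h] at h0
      simpa using h0
    -- The extra coefficient of order `d`: its `m = 0` term rests on `bᵀ A⁻¹ e = 1 = 1/0!`.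
    have hzero : ∑ m ∈ Finset.range (χ.natDegree + 1),
      χ.coeff m / ((χ.natDegree - χ.natDegree + m).factorial : ℝ) = 0 := by
      have h := hinv _ (hχ 1)
      rw [← hbinv ((Polynomial.aeval M.A χ).mulVec 1), Polynomial.aeval_eq_sum_range, Matrix.sum_mulVec, Matrix.mulVec_sum,
        dotProduct_sum] at h
      rw [← h]
      refine Finset.sum_congr rfl fun m hm => ?_
      have := Finset.mem_range.1 hm
      rw [Matrix.smul_mulVec, Matrix.mulVec_smul, dotProduct_smul, smul_eq_mul, Nat.sub_self,
        zero_add, div_eq_mul_inv]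
      congr 1
      cases m with
      | zero => rw [hbinv]; simp
      | succ m =>
        rw [Matrix.mulVec_mulVec, pow_succ', ← Matrix.mul_assoc, Matrix.nonsing_inv_mul _ hUd,
          Matrix.one_mul, hp m (by omega), one_div]
    exact Polynomial.not_consecutive_exp_coeff_eq_zero hmon hspl le_rfl hzero
      (hvan _ (by omega) (by omega))
  · have h1 : M.sigma = 0 := if_neg hσ
    exact Polynomial.not_consecutive_exp_coeff_eq_zero hmon hspl (Nat.le_succ _)
      (hvan _ (by omega) (by omega)) (hvan _ (by omega) (by omega))

end RKScheme

/-! ### Lower bound for the dimension of the unobservable space -/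

namespace RKScheme

variable {s : ℕ} {M : RKScheme s}

open Polynomial in
/-- If the weak stage order is at least `q`, then `A π'(c) - π(c)` is unobservable for every
polynomial `π` of degree at most `q` with `π(0) = 0`. -/
theorem WSOCondition.polynomial_residual_mem {q : ℕ} (h : M.WSOCondition q) {P : ℝ[X]}
    (hd : P.natDegree ≤ q) (h0 : P.eval 0 = 0) :
    (M.A.mulVec fun i => (derivative P).eval (M.c i)) - (fun i => P.eval (M.c i))
      ∈ M.unobservable := by
  have hτ : ∀ k, 1 ≤ k → k ≤ q → M.tau k ∈ M.unobservable := fun k h1 hk =>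
    mem_unobservable_of_lt fun j hj => h j k hj h1 hk
  have hP0 : P.coeff 0 = 0 := by rw [coeff_zero_eq_eval_zero, h0]
  -- The monomial `X^(k+1)` has residual `(k + 1) τ⁽ᵏ⁺¹⁾`.
  have : (M.A.mulVec fun i => (derivative P).eval (M.c i)) - (fun i => P.eval (M.c i))
      = ∑ k ∈ Finset.range q, (P.coeff (k + 1) * ((k : ℝ) + 1)) • M.tau (k + 1) := by
    ext i
    have e1 : ∀ x, P.eval x = ∑ k ∈ Finset.range q, P.coeff (k + 1) * x ^ (k + 1) := by
      intro x
      rw [eval_eq_sum_range' (Nat.lt_succ_of_le hd), Finset.sum_range_succ', hP0]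
      simp
    have e2 : ∀ x, (derivative P).eval x
        = ∑ k ∈ Finset.range q, P.coeff (k + 1) * ((k : ℝ) + 1) * x ^ k := by
      intro x
      rcases Nat.eq_zero_or_pos q with rfl | hq
      · rw [eq_C_of_natDegree_eq_zero (Nat.le_zero.1 hd)]; simp
      · rw [eval_eq_sum_range' (n := q)
          (lt_of_le_of_lt (natDegree_derivative_le P) (by omega))]
        simp only [coeff_derivative]
    simp only [Pi.sub_apply, Matrix.mulVec, dotProduct, e1, e2, Finset.sum_apply, Pi.smul_apply,
      smul_eq_mul, tau, Nat.add_sub_cancel, Finset.mul_sum, mul_sub, Finset.sum_sub_distrib]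
    rw [Finset.sum_comm]
    congr 1
    · exact Finset.sum_congr rfl fun k _ => Finset.sum_congr rfl fun j _ => by ring
    · refine Finset.sum_congr rfl fun k _ => ?_
      have : ((k : ℝ) + 1) ≠ 0 := by positivity
      push_cast
      field_simp
  rw [this]
  exact Submodule.sum_mem _ fun k hk => Submodule.smul_mem _ _
    (hτ _ (by omega) (by have := Finset.mem_range.1 hk; omega))

/-- Vectors of a submodule whose coordinates form a triangular array with nonzero diagonal. -/
theorem card_le_finrank_of_triangular {s : ℕ} (W : Submodule ℝ (Fin s → ℝ)) (K : Finset (Fin s))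
    (h : ∀ k ∈ K, ∃ w ∈ W, w k ≠ 0 ∧ ∀ j < k, w j = 0) : K.card ≤ Module.finrank ℝ W := by
  choose! w hW hk hlt using h
  have hli : LinearIndependent ℝ (fun k : K => (⟨w k, hW k k.2⟩ : W)) := by
    rw [Fintype.linearIndependent_iff]
    intro g hg i
    induction i using WellFoundedLT.induction with
    | ind i ih =>
      have h1 : ∑ k : K, g k * w k i = 0 := by
        have := congrFun (congrArg Subtype.val hg) (i : Fin s)
        simpa [Finset.sum_apply] using this
      rw [Finset.sum_eq_single i] at h1
      · exact (mul_eq_zero.1 h1).resolve_right (hk i i.2)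
      · intro j _ hj
        rcases lt_or_gt_of_ne hj with hj | hj
        · rw [ih j hj, zero_mul]
        · rw [hlt j j.2 i hj, mul_zero]
      · simp
  simpa using hli.fintype_card_le_finrank

open Polynomial in
/-- The polynomial of degree at most `2m` (`2m - 1` if `0 ∈ S`), `m = |S|`, that has double zeros on
`S` except at `c_k`, where its residual does not vanish. -/
theorem exists_residual_polynomial {S : Finset ℝ} {x a : ℝ} (hx : x ∈ S) (ha : x = 0 → a ≠ 0) :
    ∃ P : ℝ[X], P.natDegree + (if (0 : ℝ) ∈ S then 1 else 0) ≤ 2 * S.card ∧ P.eval 0 = 0 ∧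
      a * (derivative P).eval x - P.eval x ≠ 0 ∧
      ∀ y ∈ S, y ≠ x → P.eval y = 0 ∧ (derivative P).eval y = 0 := by
  -- The factor `X` secures `P(0) = 0`. It is not needed if `0 ∈ S`, which saves one degree.
  set Z : ℝ[X] := if (0 : ℝ) ∈ S then 1 else X with hZ
  set B : ℝ[X] := (∏ y ∈ S.erase x, (X - C y)) ^ 2 * Z with hB
  have hcard : (S.erase x).card + 1 = S.card := Finset.card_erase_add_one hx
  have hZd : Z.natDegree + (if (0 : ℝ) ∈ S then 1 else 0) ≤ 1 := by
    rw [hZ]; split_ifs <;> simp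
  have hBd : B.natDegree + (if (0 : ℝ) ∈ S then 1 else 0) + 1 ≤ 2 * S.card := by
    have h1 := natDegree_mul_le (p := (∏ y ∈ S.erase x, (X - C y)) ^ 2) (q := Z)
    rw [← hB] at h1
    have h2 := natDegree_pow_le (p := ∏ y ∈ S.erase x, (X - C y)) (n := 2)
    rw [natDegree_prod_of_monic _ _ fun y _ => monic_X_sub_C y] at h2
    simp only [natDegree_X_sub_C, Finset.sum_const, smul_eq_mul, mul_one] at h2
    omega
  have hBx : B.eval x ≠ 0 := by
    rw [hB, eval_mul, eval_pow, eval_prod]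
    refine mul_ne_zero (pow_ne_zero _ (Finset.prod_ne_zero_iff.2 fun y hy => ?_)) ?_
    · simpa [sub_eq_zero] using (Finset.ne_of_mem_erase hy).symm
    · rw [hZ]
      split_ifs with h
      · simp
      · rw [eval_X]; rintro rfl; exact h hx
  have hB0 : x ≠ 0 → B.eval 0 = 0 := by
    intro hx0
    rw [hB, eval_mul, eval_pow, eval_prod]
    by_cases h : (0 : ℝ) ∈ S
    · rw [Finset.prod_eq_zero (Finset.mem_erase.2 ⟨hx0.symm, h⟩) (by simp)]; simp
    · simp [hZ, h]
  have hBy : ∀ y ∈ S, y ≠ x → B.eval y = 0 ∧ (derivative B).eval y = 0 := by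
    intro y hy hyx
    have h0 : eval y (∏ z ∈ S.erase x, (X - C z)) = 0 := by
      rw [eval_prod]
      exact Finset.prod_eq_zero (Finset.mem_erase.2 ⟨hyx, hy⟩) (by simp)
    rw [hB]
    simp [derivative_mul, derivative_pow, h0]
  -- If `a = 0`, then `B` has residual `-B(x)`; otherwise `B (X - x)` has residual `a B(x)`. If `x =
  -- 0`, the factor `X - x` also supplies the zero at the origin, hence the assumption `a ≠ 0`
  -- there.
  by_cases ha0 : a = 0
  · exact ⟨B, by omega, hB0 fun h => ha h ha0, by simpa [ha0] using hBx, hBy⟩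
  · refine ⟨B * (X - C x), ?_, ?_, ?_, fun y hy hyx => ?_⟩
    · have := natDegree_mul_le (p := B) (q := X - C x)
      rw [natDegree_X_sub_C] at this
      omega
    · by_cases hx0 : x = 0
      · simp [hx0]
      · simp [hB0 hx0]
    · simpa [derivative_mul] using ⟨ha0, hBx⟩
    · obtain ⟨h1, h2⟩ := hBy y hy hyx
      simp [derivative_mul, h1, h2]

/-- The set of the abscissas of the first `n` stages. -/
noncomputable def firstAbscissas (M : RKScheme s) (n : ℕ) : Finset ℝ :=
  (Finset.univ.filter fun i : Fin s => (i : ℕ) < n).image M.c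

theorem firstAbscissas_mono {n n' : ℕ} (h : n ≤ n') :
    M.firstAbscissas n ⊆ M.firstAbscissas n' :=
  Finset.image_subset_image fun i hi => by
    simp only [Finset.mem_filter, Finset.mem_univ, true_and] at hi ⊢
    omega

/-- Discrete intermediate value argument: each further stage adds at most one abscissa. -/
theorem exists_card_firstAbscissas {m : ℕ} (hm : m ≤ M.numAbscissas) :
    ∃ n, (M.firstAbscissas n).card = m := by
  have hs : (M.firstAbscissas s).card = M.numAbscissas := by
    simp [firstAbscissas, numAbscissas]
  have hstep : ∀ n, (M.firstAbscissas (n + 1)).card ≤ (M.firstAbscissas n).card + 1 := by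
    intro n
    by_cases hn : n < s
    · refine le_trans (Finset.card_le_card (t := insert (M.c ⟨n, hn⟩) (M.firstAbscissas n)) ?_)
        (Finset.card_insert_le _ _)
      intro x hx
      simp only [firstAbscissas, Finset.mem_image, Finset.mem_filter, Finset.mem_univ, true_and,
        Finset.mem_insert] at hx ⊢
      obtain ⟨i, hi, rfl⟩ := hx
      rcases Nat.lt_succ_iff_lt_or_eq.1 hi with hi | hi
      · exact Or.inr ⟨i, hi, rfl⟩
      · exact Or.inl (congrArg M.c (Fin.ext hi))
    · refine (Finset.card_le_card fun x hx => ?_).trans (Nat.le_succ _)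
      simp only [firstAbscissas, Finset.mem_image, Finset.mem_filter, Finset.mem_univ,
        true_and] at hx ⊢
      obtain ⟨i, _, rfl⟩ := hx
      exact ⟨i, by have := i.2; omega, rfl⟩
  have : ∀ n, m ≤ (M.firstAbscissas n).card → ∃ n, (M.firstAbscissas n).card = m := by
    intro n
    induction n with
    | zero =>
      intro h
      exact ⟨0, by simp [firstAbscissas] at h ⊢; exact h.symm⟩
    | succ n ih =>
      intro h
      by_cases h' : m ≤ (M.firstAbscissas n).card
      · exact ih h'
      · exact ⟨n + 1, by have := hstep n; omega⟩
  exact this s (by omega)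

/-- Each stage at which a new abscissa appears contributes one vector of a triangular family in `W`.
The only possible exception is the first stage with `c = 0`, when its diagonal entry vanishes; this
is the GEDIRK case and costs `κ`. -/
theorem IsDIRK.card_firstAbscissas_le (hM : M.IsDIRK) {q n : ℕ} (h : M.WSOCondition q)
    (hq : 2 * (M.firstAbscissas n).card ≤ q + if (0 : ℝ) ∈ M.firstAbscissas n then 1 else 0) :
    (M.firstAbscissas n).card ≤ Module.finrank ℝ M.unobservable +
      if (0 : ℝ) ∈ M.firstAbscissas n then M.kappa else 0 := by
  classical
  set S := M.firstAbscissas n with hS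
  -- `F` collects the first occurrences of the abscissas; `K` drops the exceptional GEDIRK stage.
  set F : Finset (Fin s) := Finset.univ.filter fun k => (k : ℕ) < n ∧ ∀ j < k, M.c j ≠ M.c k
  set K : Finset (Fin s) := F.filter fun k => M.c k = 0 → M.A k k ≠ 0
  have hcS : ∀ i : Fin s, (i : ℕ) < n → M.c i ∈ S := fun i hi =>
    Finset.mem_image_of_mem _ (by simpa using hi)
  have hFS : S.card ≤ F.card := by
    refine (Finset.card_le_card fun x hx => ?_).trans (Finset.card_image_le (f := M.c))
    obtain ⟨i, hi, rfl⟩ := Finset.mem_image.1 hx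
    obtain ⟨k, hk, hmin⟩ := WellFounded.has_min (wellFounded_lt (α := Fin s))
      {j | M.c j = M.c i} ⟨i, rfl⟩
    have hki : k ≤ i := not_lt.1 (hmin i rfl)
    have hk' : M.c k = M.c i := hk
    refine Finset.mem_image.2 ⟨k, ?_, hk⟩
    simp only [F, Finset.mem_filter, Finset.mem_univ, true_and] at hi ⊢
    exact ⟨lt_of_le_of_lt hki hi, fun j hj hjk => hmin j (hjk.trans hk') hj⟩
  have hFK : F.card ≤ K.card + if (0 : ℝ) ∈ S then M.kappa else 0 := by
    rw [← Finset.card_filter_add_card_filter_not (s := F) (fun k => M.c k = 0 → M.A k k ≠ 0)]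
    refine Nat.add_le_add_left ?_ _
    rcases (F.filter fun k => ¬ (M.c k = 0 → M.A k k ≠ 0)).eq_empty_or_nonempty with he | ⟨l, hl⟩
    · rw [he]; simp
    · simp only [F, Finset.mem_filter, Finset.mem_univ, true_and, not_forall, not_not] at hl
      obtain ⟨⟨hln, hmin⟩, hl0, hll⟩ := hl
      have hκ : M.kappa = 1 :=
        if_pos ⟨hM, l, hl0, fun j hj => by rw [← hl0]; exact hmin j hj, hll⟩
      rw [if_pos (by rw [← hl0]; exact hcS l hln), hκ]
      refine Finset.card_le_one.2 fun i hi j hj => ?_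
      simp only [F, Finset.mem_filter, Finset.mem_univ, true_and, not_forall, not_not] at hi hj
      obtain ⟨⟨_, hi1⟩, hi0, _⟩ := hi
      obtain ⟨⟨_, hj1⟩, hj0, _⟩ := hj
      rcases lt_trichotomy i j with hij | hij | hij
      · exact absurd (hi0.trans hj0.symm) (hj1 i hij)
      · exact hij
      · exact absurd (hj0.trans hi0.symm) (hi1 j hij)
  have hK : K.card ≤ Module.finrank ℝ M.unobservable := by
    refine card_le_finrank_of_triangular _ _ fun k hk => ?_
    simp only [K, F, Finset.mem_filter, Finset.mem_univ, true_and] at hk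
    obtain ⟨⟨hkn, hkf⟩, hka⟩ := hk
    obtain ⟨P, hPd, hP0, hPk, hPy⟩ := exists_residual_polynomial (hcS k hkn) hka
    have hz : ∀ j < k, P.eval (M.c j) = 0 ∧ (Polynomial.derivative P).eval (M.c j) = 0 :=
      fun j hj => hPy _ (hcS j (lt_trans hj hkn)) (hkf j hj)
    -- Row `j` of `A` involves only stages up to `j`. Since `P` and `P'` vanish at all abscissas
    -- before stage `k`, the residual is zero before `k`, and at `k` only the diagonal term and
    -- `P(c_k)` survive.
    refine ⟨_, h.polynomial_residual_mem (P := P) (by omega) hP0, ?_, fun j hj => ?_⟩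
    · convert hPk using 1
      rw [Pi.sub_apply, Matrix.mulVec, dotProduct, Finset.sum_eq_single k]
      · intro j _ hj
        rcases lt_or_gt_of_ne hj with hj | hj
        · rw [(hz j hj).2, mul_zero]
        · rw [hM k j hj, zero_mul]
      · simp
    · rw [Pi.sub_apply, (hz j hj).1, sub_zero, Matrix.mulVec, dotProduct]
      refine Finset.sum_eq_zero fun i _ => ?_
      rcases le_or_gt i j with hij | hij
      · rw [(hz i (lt_of_le_of_lt hij hj)).2, mul_zero]
      · rw [hM j i hij, zero_mul]
  omega

theorem kappa_le_one : M.kappa ≤ 1 := by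
  unfold kappa; split_ifs <;> simp

theorem IsDIRK.half_weakStageOrder_le (hM : M.IsDIRK) {q : ℕ} (h : M.WSOCondition q)
    (hq : q + 1 ≤ 2 * M.numAbscissas) :
    (q + M.kappa) / 2 ≤ Module.finrank ℝ M.unobservable + M.kappa := by
  have hκ := kappa_le_one (M := M)
  -- With `m = ⌊(q + κ)/2⌋`, a block of `m` abscissas needs degree `2m ≤ q + 1`, affordable if it
  -- contains `0`. Otherwise the smaller block of `m - κ` abscissas avoids `0` too, and `2(m - κ) ≤
  -- q` suffices.
  obtain ⟨n, hn⟩ := exists_card_firstAbscissas (M := M) (m := (q + M.kappa) / 2) (by omega)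
  obtain ⟨n', hn'⟩ := exists_card_firstAbscissas (M := M) (m := (q + M.kappa) / 2 - M.kappa)
    (by omega)
  by_cases h0 : (0 : ℝ) ∈ M.firstAbscissas n
  · have := hM.card_firstAbscissas_le h (n := n) (by rw [if_pos h0]; omega)
    rw [if_pos h0] at this
    omega
  · by_cases h1 : (0 : ℝ) ∈ M.firstAbscissas n'
    · exfalso
      rcases le_total n' n with hnn | hnn
      · exact h0 (firstAbscissas_mono hnn h1)
      · have := Finset.eq_of_subset_of_card_le (firstAbscissas_mono (M := M) hnn) (by omega)
        exact h0 (this ▸ h1)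
    · have := hM.card_firstAbscissas_le h (n := n') (by rw [if_neg h1]; omega)
      rw [if_neg h1] at this
      omega

end RKScheme

/-! ### The case of maximal order, and the main theorem -/

namespace RKScheme

variable {s : ℕ} {M : RKScheme s}

theorem wsoCondition_of_weakStageOrder_eq {q : ℕ} (h : M.weakStageOrder = (q : ℕ∞)) :
    M.WSOCondition q := by
  -- A finite supremum of a nonempty set in `ℕ∞` is attained; `S(0)` holds vacuously.
  have : Nonempty {x : ℕ∞ | ∃ ξ : ℕ, x = (ξ : ℕ∞) ∧ M.WSOCondition ξ} :=
    ⟨⟨0, 0, rfl, fun j k _ h1 h0 => by omega⟩⟩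
  have hmem := ENat.sSup_mem_of_nonempty_of_lt_top
    (s := {x : ℕ∞ | ∃ ξ : ℕ, x = (ξ : ℕ∞) ∧ M.WSOCondition ξ})
    (lt_of_eq_of_lt h (ENat.natCast_lt_top q))
  obtain ⟨ξ, hξ, hw⟩ := hmem
  have : q = ξ := by exact_mod_cast h.symm.trans hξ
  rwa [this]

/-- A diagonally implicit scheme with `τ⁽²⁾ = τ⁽³⁾ = 0` has `c = 0`. -/
theorem IsDIRK.c_eq_zero (hM : M.IsDIRK) (h2 : M.tau 2 = 0) (h3 : M.tau 3 = 0) : M.c = 0 := by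
  ext i
  induction i using WellFoundedLT.induction with
  | ind i ih =>
    have key : ∀ n : ℕ, n ≠ 0 → ∑ j, M.A i j * M.c j ^ n = M.A i i * M.c i ^ n := by
      intro n hn
      refine Finset.sum_eq_single i (fun j _ hj => ?_) (by simp)
      rcases lt_or_gt_of_ne hj with hj | hj
      · rw [ih j hj]; simp [hn]
      · rw [hM i j hj, zero_mul]
    have e2 : (∑ j, M.A i j * M.c j ^ 1) - M.c i ^ 2 / (2 : ℕ) = 0 := congrFun h2 i
    have e3 : (∑ j, M.A i j * M.c j ^ 2) - M.c i ^ 3 / (3 : ℕ) = 0 := congrFun h3 i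
    rw [key _ one_ne_zero] at e2
    rw [key _ two_ne_zero] at e3
    push_cast at e2 e3
    -- With earlier abscissas zero, `a c = c²/2` and `a c² = c³/3` for `a = a_ii`, `c = c_i`;
    -- eliminating `a` leaves `c³ = 0`.
    have : M.c i ^ 3 = 0 := by linear_combination 6 * e3 - 6 * M.c i * e2
    simpa using this

/-- If the unobservable space is trivial, the weak stage order is at most `2`. -/
theorem IsDIRK.le_two_of_unobservable_eq_bot (hM : M.IsDIRK) {p : ℕ} (hp : M.HasOrder p)
    (hps : p + M.sigma = s + 1) (hW : M.unobservable = ⊥) {q : ℕ} (h : M.WSOCondition q) :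
    q ≤ 2 := by
  by_contra hq
  have hτ : ∀ k, 1 ≤ k → k ≤ 3 → M.tau k = 0 := fun k h1 hk => by
    have : M.tau k ∈ M.unobservable :=
      mem_unobservable_of_lt fun j hj => h j k hj h1 (by omega)
    rwa [hW, Submodule.mem_bot] at this
  have hc := hM.c_eq_zero (hτ 2 (by omega) (by omega)) (hτ 3 (by omega) (by omega))
  have hce : M.A.mulVec 1 = 0 := by
    rw [← hc]; ext i; simp [Matrix.mulVec, dotProduct, c]
  -- Once `s ≥ 1` and `σ = 0`, the order is `p = s + 1 ≥ 2`, so `bᵀ A e = 1/2` is available against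
  -- `A e = c = 0`.
  have hs : s ≠ 0 := by
    rintro rfl
    have hσ : M.sigma = 0 := if_neg fun ⟨_, l, _⟩ => l.elim0
    have := hp.tall_tree_condition (i := 0) (by omega)
    simp [dotProduct] at this
  have hσ : M.sigma = 0 := by
    refine if_neg fun ⟨hU, _⟩ => ?_
    have h1 := Matrix.mulVec_injective_of_isUnit hU (hce.trans (Matrix.mulVec_zero _).symm)
    have := congrFun h1 ⟨0, by omega⟩
    simp at this
  have := hp.tall_tree_condition (i := 1) (by omega)
  rw [pow_one, hce, dotProduct_zero] at this
  norm_num [Nat.factorial] at this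

theorem IsDIRK.weakStageOrder_le_two (hM : M.IsDIRK) {p : ℕ} (hp : M.HasOrder p)
    (hps : p + M.sigma = s + 1) : M.weakStageOrder ≤ 2 := by
  have h := hM.order_add_finrank_le fun i hi => hp.tall_tree_condition hi
  have hW : M.unobservable = ⊥ := Submodule.finrank_eq_zero.1 (by omega)
  refine sSup_le ?_
  rintro x ⟨ξ, rfl, hξ⟩
  exact_mod_cast hM.le_two_of_unobservable_eq_bot hp hps hW hξ

end RKScheme

theorem mainTheorem2 (s : ℕ) (M : RKScheme s) (hM : M.IsDIRK) (p : ℕ) (hp : M.HasOrder p) :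
    (∀ q : ℕ, M.weakStageOrder = (q : ℕ∞) → (q : ℤ) ≤ 2 * (M.numAbscissas : ℤ) - 1 →
      ⌊((q : ℝ) + (M.kappa : ℝ)) / 2⌋ - (M.kappa : ℤ) + (p : ℤ)
          ≤ (s : ℤ) + 1 - (M.sigma : ℤ) ∧
      ((p : ℤ) = (s : ℤ) - (M.sigma : ℤ) →
        (¬ M.IsGEDIRK → q ≤ 3) ∧ (M.IsGEDIRK → q ≤ 4))) ∧
    ((p : ℤ) = (s : ℤ) + 1 - (M.sigma : ℤ) →
      (¬ M.IsGEDIRK → M.weakStageOrder ≤ 3) ∧ (M.IsGEDIRK → M.weakStageOrder ≤ 4)) := by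
  have hord := hM.order_add_finrank_le fun i hi => hp.tall_tree_condition hi
  refine ⟨fun q hq hn => ?_, fun hps => ?_⟩
  · have hdim := hM.half_weakStageOrder_le (RKScheme.wsoCondition_of_weakStageOrder_eq hq) (by omega)
    refine ⟨?_, fun hps => ⟨fun hG => ?_, fun hG => ?_⟩⟩
    · have hfl : ⌊((q : ℝ) + (M.kappa : ℝ)) / 2⌋ = (((q + M.kappa) / 2 : ℕ) : ℤ) := by
        have h := Nat.floor_div_eq_div (K := ℝ) (q + M.kappa) 2
        rw [← h, Int.natCast_floor_eq_floor (by positivity)]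
        push_cast
        rfl
      rw [hfl]
      omega
    -- For `p = s - σ` the order barrier leaves `dim W ≤ 1`, so `⌊(q + κ)/2⌋ ≤ 1 + κ`.
    · have hκ : M.kappa = 0 := if_neg hG
      omega
    · have hκ : M.kappa = 1 := if_pos hG
      omega
  · have h := hM.weakStageOrder_le_two hp (by omega)
    exact ⟨fun _ => h.trans (by norm_num), fun _ => h.trans (by norm_num)⟩
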